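/- Let $\Bbbk$ be a field and let $\mathcal{M}$ be a nonempty class of finite matroids, closed under isomorphism, direct sums and minors. Let $\Bbbk\widetilde{\mathcal{M}}$ be its matroid-minor Hopf algebra: the $\Bbbk$-vector space with basis the isomorphism classes of matroids in $\mathcal{M}$, with product $M\cdot N=M\oplus N$, unit the empty matroid, coproduct $\Delta(M)=\sum_{A\subseteq E(M)}M|_A\otimes M/A$, and counit $\epsilon(M)=1$ if $E(M)=\emptyset$ and $\epsilon(M)=0$ otherwise. For a finite set $X$ and $0\le s\le |X|$, let $U_X^s$ denote the uniform matroid of rank $s$ with ground set $X$. Let $E$ be a totally ordered set with $n$ elements, let $1\le r\le n$, and suppose that $U_n^r=U_E^r$ belongs to $\mathcal{M}$. Then all the matroids on the right-hand side below belong to $\mathcal{M}$, and the antipode $S$ of $\Bbbk\widetilde{\mathcal{M}}$ satisfies $$S(U_n^r)=\sum_{I,J}(-1)^{n-|J|+1}\;U_I^{|I|}\oplus U_J^{r-|I|}\oplus U_{E\setminus(I\cup J)}^{0},$$ where the sum ranges over all pairs $(I,J)$ of subsets of $E$ such that - $I$ and $J$ are disjoint, - $|I|<r$, - $|I|+|J|\ge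 r$, and - if $|I|+|J|=r$, then $J=\{x\}$ is a singleton and $\max(I)<x$ (a condition that holds for every $x$ if $I=\emptyset$). -/

import Mathlib

open scoped TensorProduct Matroid

namespace MatroidMinor

section Iso

variable {α β γ δ : Type*}

/-- Isomorphism of matroids: a bijection between the ground sets under which independent sets
correspond to independent sets. -/
def IsIso (M : Matroid α) (N : Matroid β) : Prop :=
  ∃ e : M.E ≃ N.E, ∀ I : Set M.E,
    M.Indep (Subtype.val '' I) ↔ N.Indep (Subtype.val '' (e '' I))

theorem IsIso.refl (M : Matroid α) : IsIso M M :=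
  ⟨Equiv.refl _, fun I => by simp⟩

theorem IsIso.symm {M : Matroid α} {N : Matroid β} (h : IsIso M N) : IsIso N M := by
  obtain ⟨e, he⟩ := h
  refine ⟨e.symm, fun I => ?_⟩
  have := he (e.symm '' I)
  rw [this, Set.image_image e]
  simp

theorem IsIso.trans {M : Matroid α} {N : Matroid β} {O : Matroid γ}
    (h : IsIso M N) (h' : IsIso N O) : IsIso M O := by
  obtain ⟨e, he⟩ := h
  obtain ⟨f, hf⟩ := h'
  refine ⟨e.trans f, fun I => ?_⟩
  rw [he, hf, Set.image_image f]
  rfl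

theorem isIso_map (M : Matroid α) (f : α → β) (hf : Set.InjOn f M.E) : IsIso M (M.map f hf) := by
  refine ⟨Equiv.Set.imageOfInjOn f M.E hf, fun I => ?_⟩
  have : (Subtype.val '' ((Equiv.Set.imageOfInjOn f M.E hf) '' I)) =
      f '' (Subtype.val '' I) := by
    rw [← Set.image_comp, ← Set.image_comp]; rfl
  refine Iff.trans ?_ (Iff.of_eq (congrArg _ this)).symm
  exact (Matroid.map_image_indep_iff (by simp)).symm

theorem IsIso.exists_map [Nonempty β] {M : Matroid α} {N : Matroid β} (h : IsIso M N) :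
    ∃ (f : α → β) (hf : Set.InjOn f M.E), N = M.map f hf := by
  classical
  obtain ⟨e, he⟩ := h
  let f : α → β := fun x => if hx : x ∈ M.E then e ⟨x, hx⟩ else Classical.arbitrary β
  have hfe : ∀ x : M.E, f x = e x := fun x => by simp [f]
  have hf : Set.InjOn f M.E := by
    intro x hx y hy hxy
    have := (hfe ⟨x, hx⟩).symm.trans (hxy.trans (hfe ⟨y, hy⟩))
    simpa using e.injective (Subtype.val_injective this)
  have key : ∀ I : Set M.E, f '' (Subtype.val '' I) = Subtype.val '' (e '' I) := fun I => by
    rw [← Set.image_comp, ← Set.image_comp]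
    exact Set.image_congr fun x _ => hfe x
  have hE : N.E = f '' M.E := by
    have := key Set.univ
    simpa using this.symm
  refine ⟨f, hf, Matroid.ext_indep hE fun J hJ => ?_⟩
  obtain ⟨I, hI, rfl⟩ := Set.subset_image_iff.1 (hE ▸ hJ)
  rw [Matroid.map_image_indep_iff hI]
  obtain ⟨I', rfl⟩ : ∃ I' : Set M.E, Subtype.val '' I' = I :=
    ⟨Subtype.val ⁻¹' I, by simpa using hI⟩
  rw [key, he]

theorem map_restrict (M : Matroid α) (f : α → β) (hf : Set.InjOn f M.E) {A : Set α}
    (hA : A ⊆ M.E) : (M.map f hf) ↾ (f '' A) = (M ↾ A).map f (hf.mono hA) := by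
  refine Matroid.ext_indep (by simp) fun J hJ => ?_
  obtain ⟨I, hI, rfl⟩ := Set.subset_image_iff.1 (show J ⊆ f '' A from hJ)
  rw [Matroid.restrict_indep_iff, Matroid.map_image_indep_iff (hI.trans hA),
    Matroid.map_image_indep_iff (show I ⊆ (M ↾ A).E from hI), Matroid.restrict_indep_iff]
  simp only [hI, Set.image_mono hI, and_true]

theorem map_delete (M : Matroid α) (f : α → β) (hf : Set.InjOn f M.E) {A : Set α}
    (hA : A ⊆ M.E) :
    (M.map f hf) ＼ (f '' A) = (M ＼ A).map f (hf.mono Set.sdiff_subset) := by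
  rw [Matroid.delete_eq_restrict, Matroid.map_ground, ← hf.image_sdiff_subset hA,
    map_restrict _ _ _ Set.sdiff_subset]
  rfl

theorem map_contract (M : Matroid α) (f : α → β) (hf : Set.InjOn f M.E) {A : Set α}
    (hA : A ⊆ M.E) :
    (M.map f hf) ／ (f '' A) = (M ／ A).map f (hf.mono Set.sdiff_subset) := by
  rw [← Matroid.dual_inj, Matroid.dual_contract, Matroid.map_dual, Matroid.map_dual]
  have h := map_delete M✶ f hf hA
  rw [h]
  congr 1
  rw [Matroid.dual_contract]

theorem map_sum_map (M : Matroid α) (N : Matroid β) (f : α → γ) (hf : Set.InjOn f M.E)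
    (g : β → δ) (hg : Set.InjOn g N.E) :
    ∃ h, (M.map f hf).sum (N.map g hg) = (M.sum N).map (Sum.map f g) h := by
  have hinj : Set.InjOn (Sum.map f g) (M.sum N).E := by
    rw [Matroid.sum_ground]
    rintro (x | x) hx (y | y) hy hxy <;> simp at hx hy hxy ⊢
    · exact hf hx hy hxy
    · exact hg hx hy hxy
  have hE : ((M.map f hf).sum (N.map g hg)).E = Sum.map f g '' (M.sum N).E := by
    simp [Set.image_union, Set.image_image]
  refine ⟨hinj, Matroid.ext_indep hE fun J hJ => ?_⟩
  rw [hE] at hJ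
  obtain ⟨I, hI, rfl⟩ := Set.subset_image_iff.1 hJ
  have h1 : Sum.inl ⁻¹' (Sum.map f g '' I) = f '' (Sum.inl ⁻¹' I) := by
    ext x; simp
  have h2 : Sum.inr ⁻¹' (Sum.map f g '' I) = g '' (Sum.inr ⁻¹' I) := by
    ext x; simp
  rw [Matroid.map_image_indep_iff hI, Matroid.sum_indep_iff, Matroid.sum_indep_iff, h1, h2,
    Matroid.map_image_indep_iff, Matroid.map_image_indep_iff]
  · intro x hx; simpa using hI hx
  · intro x hx; simpa using hI hx

theorem isIso_sum [Nonempty γ] [Nonempty δ] {M : Matroid α} {N : Matroid β} {M' : Matroid γ}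
    {N' : Matroid δ} (h : IsIso M M') (h' : IsIso N N') : IsIso (M.sum N) (M'.sum N') := by
  obtain ⟨f, hf, rfl⟩ := h.exists_map
  obtain ⟨g, hg, rfl⟩ := h'.exists_map
  obtain ⟨h, e⟩ := map_sum_map M N f hf g hg
  rw [e]
  exact isIso_map _ _ _

theorem isIso_sum_comm (M : Matroid α) (N : Matroid β) : IsIso (M.sum N) (N.sum M) := by
  have : N.sum M = (M.sum N).mapEquiv (Equiv.sumComm α β) := by
    refine Matroid.ext_indep ?_ fun I _ => ?_
    · ext (x | x) <;> simp
    · simp only [Matroid.sum_indep_iff, Matroid.mapEquiv_indep_iff]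
      rw [and_comm]
      have h1 : Sum.inl ⁻¹' ((Equiv.sumComm α β).symm '' I) = Sum.inr ⁻¹' I := by ext; simp
      have h2 : Sum.inr ⁻¹' ((Equiv.sumComm α β).symm '' I) = Sum.inl ⁻¹' I := by ext; simp
      rw [h1, h2]
  rw [this]
  exact isIso_map _ _ (Equiv.injective _).injOn

theorem isIso_sum_assoc (M : Matroid α) (N : Matroid β) (O : Matroid γ) :
    IsIso ((M.sum N).sum O) (M.sum (N.sum O)) := by
  have : M.sum (N.sum O) = ((M.sum N).sum O).mapEquiv (Equiv.sumAssoc α β γ) := by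
    refine Matroid.ext_indep ?_ fun I _ => ?_
    · ext (x | x | x) <;> simp
    · simp only [Matroid.sum_indep_iff, Matroid.mapEquiv_indep_iff]
      rw [and_assoc]
      have h1 : Sum.inl ⁻¹' (Sum.inl ⁻¹' ((Equiv.sumAssoc α β γ).symm '' I)) = Sum.inl ⁻¹' I := by
        ext; simp
      have h2 : Sum.inr ⁻¹' (Sum.inl ⁻¹' ((Equiv.sumAssoc α β γ).symm '' I)) =
        Sum.inl ⁻¹' (Sum.inr ⁻¹' I) := by ext; simp
      have h3 : Sum.inr ⁻¹' ((Equiv.sumAssoc α β γ).symm '' I) =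
        Sum.inr ⁻¹' (Sum.inr ⁻¹' I) := by ext; simp
      rw [h1, h2, h3]
  rw [this]
  exact isIso_map _ _ (Equiv.injective _).injOn

theorem isIso_empty_sum (M : Matroid α) : IsIso M ((Matroid.emptyOn β).sum M) := by
  have : (Matroid.emptyOn β).sum M = M.map Sum.inr Sum.inr_injective.injOn := by
    refine Matroid.ext_indep ?_ fun I hI => ?_
    · simp
    · simp only [Matroid.sum_ground, Matroid.emptyOn_ground, Set.image_empty, Set.empty_union] at hI
      obtain ⟨J, hJ, rfl⟩ := Set.subset_image_iff.1 hI
      rw [Matroid.map_image_indep_iff hJ]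
      simp [Set.preimage_image_eq _ Sum.inr_injective]
  rw [this]
  exact isIso_map _ _ _

theorem sum_restrict (M : Matroid α) (N : Matroid β) (A : Set α) (B : Set β) :
    (M.sum N) ↾ (Sum.inl '' A ∪ Sum.inr '' B) = (M ↾ A).sum (N ↾ B) := by
  refine Matroid.ext_indep (by simp) fun I hI => ?_
  simp only [Matroid.restrict_indep_iff, Matroid.sum_indep_iff]
  constructor
  · rintro ⟨⟨h1, h2⟩, h3⟩
    exact ⟨⟨h1, fun x hx => by simpa using h3 hx⟩, ⟨h2, fun x hx => by simpa using h3 hx⟩⟩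
  · rintro ⟨⟨h1, h3⟩, h2, h4⟩
    refine ⟨⟨h1, h2⟩, ?_⟩
    rintro (x | x) hx
    · exact Or.inl ⟨x, h3 hx, rfl⟩
    · exact Or.inr ⟨x, h4 hx, rfl⟩

theorem sum_contract (M : Matroid α) (N : Matroid β) {A : Set α} {B : Set β}
    (hA : A ⊆ M.E) (hB : B ⊆ N.E) :
    (M.sum N) ／ (Sum.inl '' A ∪ Sum.inr '' B) = (M ／ A).sum (N ／ B) := by
  obtain ⟨I, hI⟩ := M.exists_isBasis A
  obtain ⟨J, hJ⟩ := N.exists_isBasis B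
  have hl : ∀ (X : Set α) (Y : Set β),
      (Sum.inl ⁻¹' (Sum.inl '' X ∪ Sum.inr '' Y) : Set α) = X := fun X Y => by ext; simp
  have hr : ∀ (X : Set α) (Y : Set β),
      (Sum.inr ⁻¹' (Sum.inl '' X ∪ Sum.inr '' Y) : Set β) = Y := fun X Y => by ext; simp
  have hIJ : (M.sum N).IsBasis (Sum.inl '' I ∪ Sum.inr '' J) (Sum.inl '' A ∪ Sum.inr '' B) := by
    rw [Matroid.sum_isBasis_iff, hl, hr, hl, hr]
    exact ⟨hI, hJ⟩
  refine Matroid.ext_indep ?_ fun K _ => ?_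
  · ext (x | x) <;> simp
  · rw [hIJ.contract_indep_iff, Matroid.sum_indep_iff, Matroid.sum_indep_iff,
      hI.contract_indep_iff, hJ.contract_indep_iff, Set.preimage_union (s := K), Set.preimage_union (s := K), hl, hr]
    have : Disjoint (Sum.inl '' A ∪ Sum.inr '' B) K ↔
        Disjoint A (Sum.inl ⁻¹' K) ∧ Disjoint B (Sum.inr ⁻¹' K) := by
      simp [Set.disjoint_left, or_imp, forall_and]
    rw [this]
    tauto

end Iso

section Classes

variable {α β : Type*}

instance (E : Finset α) (M : Matroid α) : (M ↾ (E : Set α)).Finite := ⟨E.finite_toSet⟩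

instance (M : Matroid α) (N : Matroid β) [M.Finite] [N.Finite] : (M.sum N).Finite :=
  ⟨by
    rw [Matroid.sum_ground]
    exact (M.ground_finite.image _).union (N.ground_finite.image _)⟩

instance : (Matroid.emptyOn α).Finite := ⟨by simp⟩

/-- Every finite matroid is isomorphic to one whose ground set is a finite subset of `ℕ`, so the
finite matroids on `ℕ` up to isomorphism represent all isomorphism classes of finite matroids. -/
instance isoSetoid : Setoid {M : Matroid ℕ // M.Finite} where
  r M N := IsIso M.1 N.1
  iseqv := ⟨fun M => IsIso.refl M.1, IsIso.symm, IsIso.trans⟩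

/-- The set of isomorphism classes of finite matroids. -/
def IsoClass : Type := Quotient isoSetoid

namespace IsoClass

theorem exists_injOn (M : Matroid α) [M.Finite] : ∃ f : α → ℕ, Set.InjOn f M.E :=
  Set.countable_iff_exists_injOn.1 M.ground_finite.countable

/-- The isomorphism class of a finite matroid `M` on an arbitrary type; see `mk_eq_mk`. -/
noncomputable def mk (M : Matroid α) [M.Finite] : IsoClass :=
  Quotient.mk isoSetoid
    ⟨M.map (exists_injOn M).choose (exists_injOn M).choose_spec, inferInstance⟩

theorem isIso_rep_aux (M : Matroid α) [M.Finite] :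
    IsIso M (M.map (exists_injOn M).choose (exists_injOn M).choose_spec) :=
  isIso_map _ _ (exists_injOn M).choose_spec

theorem mk_eq_mk {M : Matroid α} {N : Matroid β} [M.Finite] [N.Finite] :
    mk M = mk N ↔ IsIso M N := by
  refine Quotient.eq.trans ?_
  constructor
  · intro h
    exact (isIso_rep_aux M).trans (IsIso.trans h (isIso_rep_aux N).symm)
  · intro h
    exact (isIso_rep_aux M).symm.trans (IsIso.trans h (isIso_rep_aux N))

theorem mk_congr {M N : Matroid α} [M.Finite] [N.Finite] (h : M = N) : mk M = mk N := by
  subst h; rfl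

/-- A representative of an isomorphism class. -/
noncomputable def rep (x : IsoClass) : Matroid ℕ := (Quotient.out x).1

instance (x : IsoClass) : x.rep.Finite := (Quotient.out x).2

@[simp] theorem mk_rep (x : IsoClass) : mk x.rep = x := by
  conv_rhs => rw [← Quotient.out_eq x]
  exact Quotient.sound (isIso_rep_aux _).symm

theorem isIso_rep_mk (M : Matroid α) [M.Finite] : IsIso M (mk M).rep :=
  mk_eq_mk.1 (mk_rep _).symm

/-- The product of isomorphism classes is the direct sum of matroids; see `mk_mul_mk`. -/
noncomputable instance : Mul IsoClass := ⟨fun x y => mk (x.rep.sum y.rep)⟩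

/-- The unit is the class of the empty matroid. -/
noncomputable instance : One IsoClass := ⟨mk (Matroid.emptyOn ℕ)⟩

theorem mk_mul_mk (M : Matroid α) (N : Matroid β) [M.Finite] [N.Finite] :
    mk M * mk N = mk (M.sum N) :=
  mk_eq_mk.2 (isIso_sum (isIso_rep_mk M) (isIso_rep_mk N)).symm

theorem one_def : (1 : IsoClass) = mk (Matroid.emptyOn ℕ) := rfl

protected theorem mul_comm' (x y : IsoClass) : x * y = y * x :=
  mk_eq_mk.2 (isIso_sum_comm _ _)

protected theorem one_mul' (x : IsoClass) : 1 * x = x := by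
  rw [← mk_rep x, one_def, mk_mul_mk]
  exact mk_eq_mk.2 (isIso_empty_sum _).symm

noncomputable instance : CommMonoid IsoClass where
  mul_assoc x y z := by
    rw [← mk_rep x, ← mk_rep y, ← mk_rep z]
    simp only [mk_mul_mk]
    exact mk_eq_mk.2 (isIso_sum_assoc _ _ _)
  one_mul := IsoClass.one_mul'
  mul_one x := by rw [IsoClass.mul_comm', IsoClass.one_mul']
  mul_comm := IsoClass.mul_comm'

/-- The number of elements of the ground set. -/
noncomputable def card (x : IsoClass) : ℕ := x.rep.E.ncard

theorem card_mk (M : Matroid α) [M.Finite] : (mk M).card = M.E.ncard := by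
  obtain ⟨e, -⟩ := isIso_rep_mk M
  exact (Nat.card_congr e).symm

theorem card_mul (x y : IsoClass) : (x * y).card = x.card + y.card := by
  rw [← mk_rep x, ← mk_rep y, mk_mul_mk, card_mk, card_mk, card_mk, Matroid.sum_ground,
    Set.ncard_union_eq ?_ (x.rep.ground_finite.image _) (y.rep.ground_finite.image _), Set.ncard_image_of_injective _ Sum.inl_injective,
    Set.ncard_image_of_injective _ Sum.inr_injective]
  · simp [Set.disjoint_left]

theorem mk_of_ground_empty (M : Matroid α) [M.Finite] (h : M.E = ∅) : mk M = 1 := by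
  refine mk_eq_mk.2 ⟨(Equiv.setCongr h).trans ((Equiv.equivOfIsEmpty _ _).trans
    (Equiv.setCongr (Matroid.emptyOn_ground).symm)), fun I => ?_⟩
  have : IsEmpty M.E := by rw [h]; infer_instance
  rw [Set.eq_empty_of_isEmpty I]
  simp

theorem card_eq_zero {x : IsoClass} : x.card = 0 ↔ x = 1 := by
  constructor
  · intro h
    rw [card, Set.ncard_eq_zero x.rep.ground_finite] at h
    rw [← mk_rep x, mk_of_ground_empty _ h]
  · rintro rfl
    rw [one_def, card_mk]
    simp

end IsoClass

/-- The ground set of a finite matroid, as a `Finset`. -/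
noncomputable def ground (M : Matroid α) [M.Finite] : Finset α := M.ground_finite.toFinset

@[simp] theorem coe_ground (M : Matroid α) [M.Finite] : (ground M : Set α) = M.E := by
  simp [ground]

open IsoClass

/-- For the class `x` of a matroid `M` with ground set `E`, the sum `∑_{A ⊆ E} G(M|A, M/A)`.
This does not depend on the representative; see `splitSum_mk`. -/
noncomputable def splitSum {V : Type*} [AddCommMonoid V] (x : IsoClass)
    (G : IsoClass → IsoClass → V) : V :=
  ∑ A ∈ (ground x.rep).powerset, G (mk (x.rep ↾ (A : Set ℕ))) (mk (x.rep ／ (A : Set ℕ)))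

variable {V : Type*} [AddCommMonoid V]

theorem subset_ground_iff {M : Matroid α} [M.Finite] {A : Finset α} :
    A ∈ (ground M).powerset ↔ (A : Set α) ⊆ M.E := by
  rw [Finset.mem_powerset, ← Finset.coe_subset, coe_ground]

theorem splitSum_mk (M : Matroid α) [M.Finite] (G : IsoClass → IsoClass → V) :
    splitSum (mk M) G =
      ∑ A ∈ (ground M).powerset, G (mk (M ↾ (A : Set α))) (mk (M ／ (A : Set α))) := by
  classical
  obtain ⟨f, hf, h⟩ := (isIso_rep_mk M).exists_map
  unfold splitSum
  have hE : (mk M).rep.E = f '' M.E := by rw [h]; rfl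
  symm
  refine Finset.sum_bij (fun A _ => A.image f) ?_ ?_ ?_ ?_
  · intro A hA
    rw [subset_ground_iff] at hA ⊢
    rw [hE, Finset.coe_image]
    exact Set.image_mono hA
  · intro A hA B hB hAB
    rw [subset_ground_iff] at hA hB
    have := congrArg (fun s : Finset ℕ => (s : Set ℕ)) hAB
    simp only [Finset.coe_image] at this
    exact Finset.coe_injective ((hf.image_eq_image_iff hA hB).1 this)
  · intro B hB
    rw [subset_ground_iff, hE] at hB
    obtain ⟨A, hA, hAB⟩ := Set.subset_image_iff.1 hB
    refine ⟨(M.ground_finite.subset hA).toFinset, ?_, ?_⟩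
    · rw [subset_ground_iff]; simpa using hA
    · apply Finset.coe_injective; simpa using hAB
  · intro A hA
    rw [subset_ground_iff] at hA
    congr 1
    · refine mk_eq_mk.2 ?_
      simp only [h, Finset.coe_image, map_restrict M f hf hA]
      exact isIso_map _ _ _
    · refine mk_eq_mk.2 ?_
      simp only [h, Finset.coe_image, map_contract M f hf hA]
      exact isIso_map _ _ _

theorem splitSum_one (G : IsoClass → IsoClass → V) : splitSum 1 G = G 1 1 := by
  rw [one_def, splitSum_mk]
  have : ground (Matroid.emptyOn ℕ) = ∅ := by
    apply Finset.coe_injective; simp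
  rw [this, Finset.powerset_empty, Finset.sum_singleton, ← one_def]
  congr 1 <;> exact mk_of_ground_empty _ (by simp)

theorem splitSum_mul (x y : IsoClass) (G : IsoClass → IsoClass → V) :
    splitSum (x * y) G =
      splitSum x fun a b => splitSum y fun c d => G (a * c) (b * d) := by
  classical
  rw [← mk_rep x, ← mk_rep y, mk_mul_mk, splitSum_mk, splitSum_mk]
  simp only [splitSum_mk]
  rw [← Finset.sum_product']
  symm
  have hco : ∀ (A : Finset ℕ) (B : Finset ℕ),
      ((A.disjSum B : Finset (ℕ ⊕ ℕ)) : Set (ℕ ⊕ ℕ)) = Sum.inl '' A ∪ Sum.inr '' B := by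
    intro A B; ext (x | x) <;> simp
  refine Finset.sum_bij (fun p _ => p.1.disjSum p.2) ?_ ?_ ?_ ?_
  · rintro ⟨A, B⟩ h
    simp only [Finset.mem_product, subset_ground_iff] at h ⊢
    rw [hco, Matroid.sum_ground]
    exact Set.union_subset_union (Set.image_mono h.1) (Set.image_mono h.2)
  · rintro ⟨A, B⟩ _ ⟨A', B'⟩ _ h
    simpa [Finset.disjSum_inj] using h
  · intro C hC
    refine ⟨(C.toLeft, C.toRight), ?_, ?_⟩
    · simp only [Finset.mem_product, subset_ground_iff] at hC ⊢
      constructor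
      · intro a ha
        have := hC (show Sum.inl a ∈ (C : Set (ℕ ⊕ ℕ)) by simpa using ha)
        simpa using this
      · intro a ha
        have := hC (show Sum.inr a ∈ (C : Set (ℕ ⊕ ℕ)) by simpa using ha)
        simpa using this
    · ext (x | x) <;> simp
  · rintro ⟨A, B⟩ h
    simp only [Finset.mem_product, subset_ground_iff] at h
    simp only [mk_mul_mk]
    congr 1
    · apply mk_congr
      rw [hco, sum_restrict]
    · apply mk_congr
      rw [hco, sum_contract _ _ h.1 h.2]

theorem sum_powerset_powerset [DecidableEq α] (E : Finset α) (F : Finset α → Finset α → V) :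
    ∑ A ∈ E.powerset, ∑ B ∈ A.powerset, F A B =
      ∑ B ∈ E.powerset, ∑ C ∈ (E \ B).powerset, F (B ∪ C) B := by
  rw [Finset.sum_sigma', Finset.sum_sigma']
  refine Finset.sum_bij' (fun p _ => ⟨p.2, p.1 \ p.2⟩) (fun p _ => ⟨p.1 ∪ p.2, p.1⟩) ?_ ?_ ?_ ?_ ?_
  · rintro ⟨A, B⟩ h
    simp only [Finset.mem_sigma, Finset.mem_powerset] at h ⊢
    exact ⟨h.2.trans h.1, Finset.sdiff_subset_sdiff h.1 le_rfl⟩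
  · rintro ⟨B, C⟩ h
    simp only [Finset.mem_sigma, Finset.mem_powerset] at h ⊢
    exact ⟨Finset.union_subset h.1 (h.2.trans Finset.sdiff_subset), Finset.subset_union_left⟩
  · rintro ⟨A, B⟩ h
    simp only [Finset.mem_sigma, Finset.mem_powerset] at h
    simp [Finset.union_sdiff_of_subset h.2]
  · rintro ⟨B, C⟩ h
    simp only [Finset.mem_sigma, Finset.mem_powerset, Finset.subset_sdiff] at h
    simp [Finset.union_sdiff_cancel_left h.2.2.symm]
  · rintro ⟨A, B⟩ h
    simp only [Finset.mem_sigma, Finset.mem_powerset] at h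
    simp only [Finset.union_sdiff_of_subset h.2]

theorem ground_restrict (M : Matroid α) (A : Finset α) : ground (M ↾ (A : Set α)) = A := by
  apply Finset.coe_injective; simp

theorem ground_contract [DecidableEq α] (M : Matroid α) [M.Finite] (A : Finset α) :
    ground (M ／ (A : Set α)) = ground M \ A := by
  apply Finset.coe_injective; simp

theorem splitSum_assoc (x : IsoClass) (G : IsoClass → IsoClass → IsoClass → V) :
    (splitSum x fun a b => splitSum a fun c d => G c d b) =
      splitSum x fun a b => splitSum b fun c d => G a c d := by
  classical
  have hl : (splitSum x fun a b => splitSum a fun c d => G c d b) =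
      ∑ A ∈ (ground x.rep).powerset, splitSum (mk (x.rep ↾ (A : Set ℕ)))
        fun c d => G c d (mk (x.rep ／ (A : Set ℕ))) := rfl
  have hr : (splitSum x fun a b => splitSum b fun c d => G a c d) =
      ∑ A ∈ (ground x.rep).powerset, splitSum (mk (x.rep ／ (A : Set ℕ)))
        fun c d => G (mk (x.rep ↾ (A : Set ℕ))) c d := rfl
  rw [hl, hr]
  simp only [splitSum_mk, ground_restrict, ground_contract]
  refine (sum_powerset_powerset (ground x.rep) fun A B =>
    G (mk (x.rep ↾ (A : Set ℕ) ↾ (B : Set ℕ))) (mk ((x.rep ↾ (A : Set ℕ)) ／ (B : Set ℕ)))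
      (mk (x.rep ／ (A : Set ℕ)))).trans ?_
  refine Finset.sum_congr rfl fun B hB => Finset.sum_congr rfl fun C hC => ?_
  rw [Finset.mem_powerset, Finset.subset_sdiff] at hC
  have e1 : mk (x.rep ↾ ((B ∪ C : Finset ℕ) : Set ℕ) ↾ (B : Set ℕ)) = mk (x.rep ↾ (B : Set ℕ)) := by
    apply mk_congr
    rw [Matroid.restrict_restrict_eq]
    simp
  have e2 : mk ((x.rep ↾ ((B ∪ C : Finset ℕ) : Set ℕ)) ／ (B : Set ℕ)) =
      mk ((x.rep ／ (B : Set ℕ)) ↾ (C : Set ℕ)) := by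
    apply mk_congr
    rw [Matroid.restrict_contract_eq_contract_restrict _ (by simp), ← Finset.coe_sdiff,
      Finset.union_sdiff_cancel_left hC.2.symm]
  have e3 : mk (x.rep ／ ((B ∪ C : Finset ℕ) : Set ℕ)) =
      mk ((x.rep ／ (B : Set ℕ)) ／ (C : Set ℕ)) := by
    apply mk_congr
    rw [Matroid.contract_contract, Finset.coe_union]
  rw [e1, e2, e3]

theorem splitSum_congr {x : IsoClass} {G G' : IsoClass → IsoClass → V}
    (h : ∀ A : Finset ℕ, (A : Set ℕ) ⊆ x.rep.E →
      G (mk (x.rep ↾ (A : Set ℕ))) (mk (x.rep ／ (A : Set ℕ))) =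
      G' (mk (x.rep ↾ (A : Set ℕ))) (mk (x.rep ／ (A : Set ℕ)))) :
    splitSum x G = splitSum x G' :=
  Finset.sum_congr rfl fun A hA => h A (subset_ground_iff.1 hA)

theorem card_split {x : IsoClass} {A : Finset ℕ} (hA : (A : Set ℕ) ⊆ x.rep.E) :
    (mk (x.rep ↾ (A : Set ℕ))).card + (mk (x.rep ／ (A : Set ℕ))).card = x.card := by
  rw [card_mk, card_mk, Matroid.restrict_ground_eq, Matroid.contract_ground, card, add_comm]
  exact Set.ncard_sdiff_add_ncard_of_subset hA x.rep.ground_finite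

theorem splitSum_card_left (x : IsoClass) (G : IsoClass → V) :
    (splitSum x fun a b => if a.card = 0 then G b else 0) = G x := by
  unfold splitSum
  rw [Finset.sum_eq_single ∅]
  · beta_reduce
    rw [if_pos (by rw [card_mk]; simp)]
    congr 1
    conv_rhs => rw [← mk_rep x]
    apply mk_congr
    simp
  · intro A hA hne
    refine if_neg ?_
    rw [card_mk]
    simpa using hne
  · simp

theorem splitSum_card_right (x : IsoClass) (G : IsoClass → V) :
    (splitSum x fun a b => if b.card = 0 then G a else 0) = G x := by
  unfold splitSum
  rw [Finset.sum_eq_single (ground x.rep)]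
  · beta_reduce
    rw [if_pos (by rw [card_mk]; simp)]
    congr 1
    conv_rhs => rw [← mk_rep x]
    apply mk_congr
    simp
  · intro A hA hne
    refine if_neg ?_
    rw [card_mk, Matroid.contract_ground, Set.ncard_eq_zero (x.rep.ground_finite.subset
      Set.sdiff_subset), Set.sdiff_eq_empty]
    rw [subset_ground_iff] at hA
    intro h
    apply hne
    apply Finset.coe_injective
    rw [coe_ground]
    exact hA.antisymm h
  · simp

end Classes

section Hopf

open IsoClass

/-- A class of finite matroids that is closed under direct sums and minors, given by its set of
isomorphism classes. Closure under direct sums is closure under the product of `IsoClass`. The class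
of the empty matroid, which is a minor of every matroid, belongs to it: the class is nonempty. -/
structure MatroidFamily extends Submonoid IsoClass where
  minor_mem' : ∀ (M N : Matroid ℕ) [M.Finite] [N.Finite], N ≤m M →
    IsoClass.mk M ∈ carrier → IsoClass.mk N ∈ carrier

variable {α : Type*} (k : Type*) [Field k] (P : MatroidFamily)

theorem MatroidFamily.restrict_mem {x : IsoClass} (hx : x ∈ P.toSubmonoid) {A : Finset ℕ}
    (hA : (A : Set ℕ) ⊆ x.rep.E) : IsoClass.mk (x.rep ↾ (A : Set ℕ)) ∈ P.toSubmonoid := by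
  refine P.minor_mem' x.rep _ ?_ (by rw [mk_rep]; exact hx)
  refine ⟨∅, x.rep.E \ A, ?_⟩
  rw [Matroid.contract_empty, Matroid.delete_eq_restrict, Set.sdiff_sdiff_cancel_left hA]

theorem MatroidFamily.contract_mem {x : IsoClass} (hx : x ∈ P.toSubmonoid) (A : Finset ℕ) :
    IsoClass.mk (x.rep ／ (A : Set ℕ)) ∈ P.toSubmonoid :=
  P.minor_mem' x.rep _ ⟨A, ∅, by simp⟩ (by rw [mk_rep]; exact hx)

/-- The matroid-minor Hopf algebra of a class of matroids over a field `k`: the vector space with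
basis the isomorphism classes in `P`, where the product is given by the direct sum of matroids. The
coalgebra structure below is not the usual one of a monoid algebra. -/
def MinorAlgebra : Type _ := MonoidAlgebra k P.toSubmonoid

namespace MinorAlgebra

noncomputable instance : CommRing (MinorAlgebra k P) :=
  inferInstanceAs (CommRing (MonoidAlgebra k P.toSubmonoid))

noncomputable instance : Algebra k (MinorAlgebra k P) :=
  inferInstanceAs (Algebra k (MonoidAlgebra k P.toSubmonoid))

/-- The basis element of an isomorphism class in `P`. -/
noncomputable def single : P.toSubmonoid →* MinorAlgebra k P :=
  MonoidAlgebra.of k P.toSubmonoid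

open Classical in
/-- The basis element of an isomorphism class (and `0` for a class outside `P`). -/
noncomputable def cls (x : IsoClass) : MinorAlgebra k P :=
  if h : x ∈ P.toSubmonoid then single k P ⟨x, h⟩ else 0

variable {k P}

theorem cls_of_mem {x : IsoClass} (hx : x ∈ P.toSubmonoid) : cls k P x = single k P ⟨x, hx⟩ :=
  dif_pos hx

theorem cls_mul {x y : IsoClass} (hx : x ∈ P.toSubmonoid) (hy : y ∈ P.toSubmonoid) :
    cls k P (x * y) = cls k P x * cls k P y := by
  rw [cls_of_mem hx, cls_of_mem hy, cls_of_mem (mul_mem hx hy), ← map_mul]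
  rfl

theorem cls_one : cls k P 1 = 1 := by
  rw [cls_of_mem (one_mem _)]
  exact map_one (single k P)

/-- The algebra homomorphism extending a monoid homomorphism on the basis. -/
noncomputable def lift {A : Type*} [Semiring A] [Algebra k A] (F : P.toSubmonoid →* A) :
    MinorAlgebra k P →ₐ[k] A :=
  MonoidAlgebra.lift k A P.toSubmonoid F

theorem lift_cls {A : Type*} [Semiring A] [Algebra k A] (F : P.toSubmonoid →* A) {x : IsoClass}
    (hx : x ∈ P.toSubmonoid) : lift F (cls k P x) = F ⟨x, hx⟩ := by
  rw [cls_of_mem hx]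
  exact MonoidAlgebra.lift_of F ⟨x, hx⟩

theorem hom_ext {V : Type*} [AddCommMonoid V] [Module k V] {f g : MinorAlgebra k P →ₗ[k] V}
    (h : ∀ x ∈ P.toSubmonoid, f (cls k P x) = g (cls k P x)) : f = g := by
  refine MonoidAlgebra.lhom_ext' (R := k) (M := P.toSubmonoid) (f := f) (g := g) fun x => ?_
  refine LinearMap.ext_ring ?_
  have := h x.1 x.2
  rw [cls_of_mem x.2] at this
  exact this

theorem algHom_ext {A : Type*} [Semiring A] [Algebra k A] {f g : MinorAlgebra k P →ₐ[k] A}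
    (h : ∀ x ∈ P.toSubmonoid, f (cls k P x) = g (cls k P x)) : f = g :=
  AlgHom.toLinearMap_injective (hom_ext h)

variable (k P)

/-- The comultiplication `M ↦ ∑_{A ⊆ E} M|A ⊗ M/A` on basis elements. -/
noncomputable def comulHom :
    P.toSubmonoid →* MinorAlgebra k P ⊗[k] MinorAlgebra k P where
  toFun x := splitSum x.1 fun a b => cls k P a ⊗ₜ[k] cls k P b
  map_one' := by
    rw [OneMemClass.coe_one, splitSum_one, cls_one]; rfl
  map_mul' x y := by
    rw [Submonoid.coe_mul, splitSum_mul, splitSum, splitSum, Finset.sum_mul]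
    refine Finset.sum_congr rfl fun A hA => ?_
    rw [splitSum, splitSum, Finset.mul_sum]
    refine Finset.sum_congr rfl fun B hB => ?_
    rw [subset_ground_iff] at hA hB
    rw [Algebra.TensorProduct.tmul_mul_tmul,
      cls_mul (P.restrict_mem x.2 hA) (P.restrict_mem y.2 hB),
      cls_mul (P.contract_mem x.2 A) (P.contract_mem y.2 B)]

/-- The counit on basis elements: `1` if the ground set is empty, and `0` otherwise. -/
noncomputable def counitHom : P.toSubmonoid →* k where
  toFun x := if x.1.card = 0 then 1 else 0
  map_one' := by simp [card_eq_zero]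
  map_mul' x y := by
    rw [Submonoid.coe_mul, card_mul]
    split_ifs <;> simp_all

/-- The linear extension of `comulHom`. -/
noncomputable def comulAlgHom :
    MinorAlgebra k P →ₐ[k] MinorAlgebra k P ⊗[k] MinorAlgebra k P :=
  lift (comulHom k P)

/-- The linear extension of `counitHom`. -/
noncomputable def counitAlgHom : MinorAlgebra k P →ₐ[k] k := lift (counitHom k P)

variable {k P}

theorem comulAlgHom_cls {x : IsoClass} (hx : x ∈ P.toSubmonoid) :
    comulAlgHom k P (cls k P x) = splitSum x fun a b => cls k P a ⊗ₜ[k] cls k P b :=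
  lift_cls _ hx

theorem counitAlgHom_cls {x : IsoClass} (hx : x ∈ P.toSubmonoid) :
    counitAlgHom k P (cls k P x) = if x.card = 0 then 1 else 0 :=
  lift_cls _ hx

theorem map_splitSum {V W : Type*} [AddCommMonoid V] [Module k V] [AddCommMonoid W] [Module k W]
    (f : V →ₗ[k] W) (x : IsoClass) (G : IsoClass → IsoClass → V) :
    f (splitSum x G) = splitSum x fun a b => f (G a b) :=
  map_sum f _ _

noncomputable instance : Bialgebra k (MinorAlgebra k P) :=
  Bialgebra.ofAlgHom (comulAlgHom k P) (counitAlgHom k P)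
    (by
      refine algHom_ext fun x hx => ?_
      have e1 : (splitSum x fun a b => splitSum a fun c d =>
          cls k P c ⊗ₜ[k] (cls k P d ⊗ₜ[k] cls k P b)) =
          splitSum x fun a b => splitSum b fun c d =>
          cls k P a ⊗ₜ[k] (cls k P c ⊗ₜ[k] cls k P d) :=
        splitSum_assoc x fun a c d => cls k P a ⊗ₜ[k] (cls k P c ⊗ₜ[k] cls k P d)
      rw [AlgHom.comp_apply, AlgHom.comp_apply, comulAlgHom_cls hx, ← AlgHom.toLinearMap_apply,
        ← AlgHom.toLinearMap_apply, map_splitSum, map_splitSum]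
      refine Eq.trans ?_ (e1.trans ?_)
      · refine splitSum_congr fun A hA => ?_
        simp only [AlgHom.toLinearMap_apply, Algebra.TensorProduct.map_tmul,
          comulAlgHom_cls (P.restrict_mem hx hA)]
        simp only [splitSum, TensorProduct.sum_tmul, map_sum]
        rfl
      · rw [AlgHom.comp_apply, comulAlgHom_cls hx, ← AlgHom.toLinearMap_apply, map_splitSum]
        refine splitSum_congr fun A hA => ?_
        rw [AlgHom.toLinearMap_apply, Algebra.TensorProduct.map_tmul,
          comulAlgHom_cls (P.contract_mem hx A)]
        simp only [splitSum, TensorProduct.tmul_sum]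
        rfl)
    (by
      refine algHom_ext fun x hx => ?_
      rw [AlgHom.comp_apply, comulAlgHom_cls hx, ← AlgHom.toLinearMap_apply, map_splitSum]
      refine Eq.trans ?_ (splitSum_card_left x fun b => (1 : k) ⊗ₜ[k] cls k P b)
      refine splitSum_congr fun A hA => ?_
      rw [AlgHom.toLinearMap_apply, Algebra.TensorProduct.map_tmul,
        counitAlgHom_cls (P.restrict_mem hx hA)]
      split_ifs <;> simp)
    (by
      refine algHom_ext fun x hx => ?_
      rw [AlgHom.comp_apply, comulAlgHom_cls hx, ← AlgHom.toLinearMap_apply, map_splitSum]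
      refine Eq.trans ?_ (splitSum_card_right x fun b => cls k P b ⊗ₜ[k] (1 : k))
      refine splitSum_congr fun A hA => ?_
      rw [AlgHom.toLinearMap_apply, Algebra.TensorProduct.map_tmul,
        counitAlgHom_cls (P.contract_mem hx A)]
      split_ifs <;> simp)

theorem comul_cls {x : IsoClass} (hx : x ∈ P.toSubmonoid) :
    Coalgebra.comul (R := k) (cls k P x) = splitSum x fun a b => cls k P a ⊗ₜ[k] cls k P b :=
  comulAlgHom_cls hx

theorem counit_cls {x : IsoClass} (hx : x ∈ P.toSubmonoid) :
    Coalgebra.counit (R := k) (cls k P x) = if x.card = 0 then 1 else 0 :=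
  counitAlgHom_cls hx

open WithConv

theorem conv_cls (f g : WithConv (MinorAlgebra k P →ₗ[k] MinorAlgebra k P)) {x : IsoClass}
    (hx : x ∈ P.toSubmonoid) :
    (f * g) (cls k P x) = splitSum x fun a b => f (cls k P a) * g (cls k P b) := by
  rw [LinearMap.convMul_apply, comul_cls hx]
  simp only [splitSum, map_sum]
  rfl

variable (k P)

/-- The negative of the projection that kills degree `0`: `η ∘ ε - id`. -/
noncomputable def negProj : WithConv (MinorAlgebra k P →ₗ[k] MinorAlgebra k P) :=
  1 - toConv LinearMap.id

variable {k P}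

theorem negProj_one : negProj k P (cls k P 1) = 0 := by
  change (1 : WithConv (MinorAlgebra k P →ₗ[k] MinorAlgebra k P)) (cls k P 1) - cls k P 1 = 0
  rw [LinearMap.convOne_apply, counit_cls (one_mem _), if_pos (card_eq_zero.2 rfl), map_one,
    cls_one, sub_self]

theorem negProj_pow_eq_zero {x : IsoClass} (hx : x ∈ P.toSubmonoid) {n : ℕ} (hn : x.card < n) :
    (negProj k P ^ n) (cls k P x) = 0 := by
  induction n generalizing x with
  | zero => omega
  | succ n ih =>
    rw [pow_succ, conv_cls _ _ hx]
    refine Finset.sum_eq_zero fun A hA => ?_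
    rw [subset_ground_iff] at hA
    beta_reduce
    by_cases h : (IsoClass.mk (x.rep ↾ (A : Set ℕ))).card < n
    · rw [ih (P.restrict_mem hx hA) h, zero_mul]
    · have := card_split hA
      have h0 : (IsoClass.mk (x.rep ／ (A : Set ℕ))).card = 0 := by omega
      rw [card_eq_zero.1 h0, negProj_one, mul_zero]

variable (k P)

/-- Takeuchi's formula: `∑ i, (-1)^i μ^(i-1) ∘ pr^(⊗ i) ∘ Δ^(i-1)`, the sum of the convolution
powers of `-pr`, which vanish on a class with fewer than `i` elements. -/
noncomputable def takeuchi : MinorAlgebra k P →ₗ[k] MinorAlgebra k P :=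
  (MonoidAlgebra.basis P.toSubmonoid k).constr k fun x =>
    ∑ i ∈ Finset.range (x.1.card + 1), (negProj k P ^ i) (single k P x)

variable {k P}

theorem takeuchi_cls {x : IsoClass} (hx : x ∈ P.toSubmonoid) {n : ℕ} (hn : x.card ≤ n) :
    takeuchi k P (cls k P x) = (∑ i ∈ Finset.range (n + 1), negProj k P ^ i) (cls k P x) := by
  have h1 : takeuchi k P (cls k P x) =
      ∑ i ∈ Finset.range (x.card + 1), (negProj k P ^ i) (cls k P x) := by
    rw [cls_of_mem hx]
    exact (MonoidAlgebra.basis P.toSubmonoid k).constr_basis k _ ⟨x, hx⟩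
  have h2 : (∑ i ∈ Finset.range (n + 1), negProj k P ^ i) (cls k P x) =
      ∑ i ∈ Finset.range (n + 1), (negProj k P ^ i) (cls k P x) := by
    induction n + 1 with
    | zero => rfl
    | succ m ih =>
      rw [Finset.sum_range_succ, Finset.sum_range_succ, ← ih]; rfl
  rw [h1, h2]
  refine Finset.sum_subset (Finset.range_mono (by omega)) fun i _ hi => ?_
  exact negProj_pow_eq_zero hx (by simpa using hi)

theorem one_sub_negProj : (1 : WithConv (MinorAlgebra k P →ₗ[k] MinorAlgebra k P)) - negProj k P =
    toConv LinearMap.id := by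
  rw [negProj, sub_sub_cancel]

theorem one_sub_pow_cls {x : IsoClass} (hx : x ∈ P.toSubmonoid) :
    (1 - negProj k P ^ (x.card + 1)) (cls k P x) =
      (1 : WithConv (MinorAlgebra k P →ₗ[k] MinorAlgebra k P)) (cls k P x) := by
  change (1 : WithConv (MinorAlgebra k P →ₗ[k] MinorAlgebra k P)) (cls k P x) -
    (negProj k P ^ (x.card + 1)) (cls k P x) = _
  rw [negProj_pow_eq_zero hx (Nat.lt_succ_self _), sub_zero]

theorem takeuchi_mul_id : toConv (takeuchi k P) * toConv LinearMap.id = 1 := by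
  refine WithConv.ext (hom_ext fun x hx => ?_)
  change (toConv (takeuchi k P) * toConv LinearMap.id :
    WithConv (MinorAlgebra k P →ₗ[k] MinorAlgebra k P)) (cls k P x) = _
  rw [← one_sub_pow_cls hx, ← geom_sum_mul_neg, one_sub_negProj, conv_cls _ _ hx, conv_cls _ _ hx]
  refine splitSum_congr fun A hA => ?_
  congr 1
  exact takeuchi_cls (P.restrict_mem hx hA) (by have := card_split hA; omega)

theorem id_mul_takeuchi : toConv LinearMap.id * toConv (takeuchi k P) = 1 := by
  refine WithConv.ext (hom_ext fun x hx => ?_)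
  change (toConv LinearMap.id * toConv (takeuchi k P) :
    WithConv (MinorAlgebra k P →ₗ[k] MinorAlgebra k P)) (cls k P x) = _
  rw [← one_sub_pow_cls hx, ← mul_neg_geom_sum, one_sub_negProj, conv_cls _ _ hx, conv_cls _ _ hx]
  refine splitSum_congr fun A hA => ?_
  congr 1
  exact takeuchi_cls (P.contract_mem hx A) (by have := card_split hA; omega)

noncomputable instance : HopfAlgebra k (MinorAlgebra k P) :=
  HopfAlgebra.ofConvInverse (takeuchi k P) takeuchi_mul_id id_mul_takeuchi

end MinorAlgebra

end Hopf

section Uniform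

variable {α : Type*}

/-- The uniform matroid of rank `r` with ground set `X`, where `r ≤ |X|`: the independent sets are
the subsets of `X` with at most `r` elements, so that the circuits are the subsets of `X` with
exactly `r + 1` elements. -/
noncomputable def unif (X : Finset α) (r : ℕ) : Matroid α :=
  (IndepMatroid.ofFinite X.finite_toSet (fun I => I ⊆ (X : Set α) ∧ I.ncard ≤ r)
    (by simp)
    (fun I J hJ hIJ => ⟨hIJ.trans hJ.1,
      (Set.ncard_le_ncard hIJ (X.finite_toSet.subset hJ.1)).trans hJ.2⟩)
    (fun I J hI hJ hlt => by
      have hf := X.finite_toSet.subset hI.1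
      obtain ⟨e, heJ, heI⟩ := Set.exists_mem_notMem_of_ncard_lt_ncard hlt hf
      refine ⟨e, heJ, heI, Set.insert_subset (hJ.1 heJ) hI.1, ?_⟩
      rw [Set.ncard_insert_of_notMem heI hf]
      exact hlt.trans_le hJ.2)
    (fun I hI => hI.1)).matroid

@[simp] theorem unif_ground (X : Finset α) (r : ℕ) : (unif X r).E = X := rfl

theorem unif_indep_iff (X : Finset α) (r : ℕ) (I : Set α) :
    (unif X r).Indep I ↔ I ⊆ (X : Set α) ∧ I.ncard ≤ r := Iff.rfl

instance (X : Finset α) (r : ℕ) : (unif X r).Finite := ⟨X.finite_toSet⟩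

variable (E : Type*) [Fintype E] [LinearOrder E]

/-- The pairs `(I, J)` of disjoint subsets of `E` such that `|I| < r`, `|I| + |J| ≥ r`, and, if
`|I| + |J| = r`, then `J = {x}` is a singleton and `max I < x`. -/
def pairIndex (r : ℕ) : Finset (Finset E × Finset E) :=
  Finset.univ.filter fun p =>
    Disjoint p.1 p.2 ∧ p.1.card < r ∧ r ≤ p.1.card + p.2.card ∧
      (p.1.card + p.2.card = r → ∃ x, p.2 = {x} ∧ ∀ i ∈ p.1, i < x)

variable {E}

/-- The class of the direct sum `U_I^{|I|} ⊕ U_J^{r - |I|} ⊕ U_{E - (I ∪ J)}^0`. -/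
noncomputable def pairTerm (r : ℕ) (p : Finset E × Finset E) : IsoClass :=
  IsoClass.mk (unif p.1 p.1.card) * IsoClass.mk (unif p.2 (r - p.1.card)) *
    IsoClass.mk (unif (Finset.univ \ (p.1 ∪ p.2)) 0)

end Uniform

end MatroidMinor

/-! The identity `id * S = η ∘ ε`, evaluated at a uniform matroid with nonempty ground set,
determines `S` recursively, because minors of uniform matroids are uniform (`unif_restrict`,
`unif_contract`, `sum_unif_mul_antipode`). In the sum over `A`, a small `A` restricts to a free
matroid, whose class is `coloop ^ |A|`. A large `A` contracts to rank `0`, and there the antipode is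
`(-loop) ^ m` on `m` elements (`antipode_unif_zero`).

For `Y ⊆ E` with `|Yᶜ| < r`, put `f Y = S(U_Y^{r - |Yᶜ|})`, and `f Y = 0` otherwise. The recursion
then says that the convolution of `A ↦ coloop ^ |A|` with `f` over subsets is an explicit `g`. The
convolution inverse of `A ↦ c ^ |A|` is `A ↦ (-c) ^ |A|` (`sum_powerset_inversion`), so `f E` is
explicit: a sum over disjoint `(I, J)` with `|I| < r ≤ |I| + |J|` (`antipode_unif`).

The pairs with `|I| + |J| = r` all contribute `± coloop ^ r * loop ^ (n - r)`. Group them by `D = I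
∪ J`: the signs over proper subsets `I` of `D` add up to one sign, which is the sign of the single
pair `(D \ {max D}, {max D})` (`sum_splitIndex_eq_sum_maxIndex`). This is where the condition `max I
< x` comes from; any other choice of one element per `D` would serve. -/

namespace MatroidMinor

/-! ### Minors of uniform matroids, and their decomposition into loops and coloops. -/

section UniformMinors

variable {α β : Type*}

theorem unif_restrict {X A : Finset α} (hA : A ⊆ X) (s : ℕ) :
    unif X s ↾ (A : Set α) = unif A s := by
  refine Matroid.ext_indep rfl fun I _ => ?_
  simp only [Matroid.restrict_indep_iff, unif_indep_iff]
  exact ⟨fun h => ⟨h.2, h.1.2⟩, fun h => ⟨⟨h.1.trans (Finset.coe_subset.2 hA), h.2⟩, h.1⟩⟩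

/-- A rank parameter beyond `|X|` imposes no condition, so `unif` then gives the free matroid. This
lets restrictions keep the parameter `s` instead of `min s |A|`. -/
theorem unif_eq_of_card_le {X : Finset α} {s t : ℕ} (hs : X.card ≤ s) (ht : X.card ≤ t) :
    unif X s = unif X t := by
  refine Matroid.ext_indep rfl fun I hI => ?_
  have : I.ncard ≤ X.card := by
    rw [← Set.ncard_coe_finset]
    exact Set.ncard_le_ncard hI X.finite_toSet
  simp only [unif_indep_iff, this.trans hs, this.trans ht]

theorem unif_isBasis {X A I : Finset α} {s : ℕ} (hA : A ⊆ X) (hI : I ⊆ A)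
    (hc : I.card = min s A.card) : (unif X s).IsBasis (I : Set α) (A : Set α) := by
  refine Matroid.Indep.isBasis_of_forall_insert ?_ (Finset.coe_subset.2 hI) ?_
  · rw [unif_indep_iff, Set.ncard_coe_finset]
    exact ⟨Finset.coe_subset.2 (hI.trans hA), by omega⟩
  · rintro e ⟨heA, heI⟩
    rw [Matroid.dep_iff, unif_indep_iff, Set.ncard_insert_of_notMem heI I.finite_toSet,
      Set.ncard_coe_finset]
    refine ⟨fun h => ?_, Set.insert_subset (Finset.coe_subset.2 hA heA)
      (Finset.coe_subset.2 (hI.trans hA))⟩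
    have h1 := h.2
    have h2 := Finset.eq_of_subset_of_card_le hI (by omega)
    exact heI (by rwa [h2])

/-- A basis of `A` has `min s |A|` elements, which leaves room for `s - min s |A|` more. Truncated
subtraction gives exactly this number, also when `A` spans and only loops remain. -/
theorem unif_contract [DecidableEq α] {X A : Finset α} (hA : A ⊆ X) (s : ℕ) :
    unif X s ／ (A : Set α) = unif (X \ A) (s - A.card) := by
  obtain ⟨I, hI, hc⟩ := Finset.exists_subset_card_eq (min_le_right s A.card)
  refine Matroid.ext_indep (by simp) fun J hJ => ?_
  replace hJ : J ⊆ (X : Set α) \ A := hJ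
  have hd : Disjoint J A := Set.disjoint_of_subset_left hJ Set.disjoint_sdiff_left
  have hJf : J.Finite := X.finite_toSet.subset (hJ.trans Set.sdiff_subset)
  rw [(unif_isBasis hA hI hc).contract_indep_iff, unif_indep_iff, unif_indep_iff,
    Finset.coe_sdiff, Set.ncard_union_eq (hd.mono_right (Finset.coe_subset.2 hI)) hJf
      I.finite_toSet, Set.ncard_coe_finset]
  have hle : J.ncard + A.card ≤ X.card := by
    rw [← Set.ncard_coe_finset, ← Set.ncard_coe_finset X,
      ← Set.ncard_union_eq hd hJf A.finite_toSet]
    exact Set.ncard_le_ncard (Set.union_subset (hJ.trans Set.sdiff_subset)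
      (Finset.coe_subset.2 hA)) X.finite_toSet
  constructor
  · rintro ⟨⟨-, h⟩, -⟩
    refine ⟨hJ, ?_⟩
    rcases le_total s A.card with h' | h' <;> simp only [h', min_eq_left, min_eq_right] at hc <;>
      omega
  · rintro ⟨-, h⟩
    refine ⟨⟨Set.union_subset (hJ.trans Set.sdiff_subset)
      (Finset.coe_subset.2 (hI.trans hA)), ?_⟩, hd.symm⟩
    -- If `J` is nonempty, the bound `h` forces `|A| < s`, so the subtraction is not truncated; if
    -- `J` is empty, only `|I| ≤ s` is needed.
    rcases Nat.eq_zero_or_pos J.ncard with h0 | h0 <;> omega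

theorem isIso_unif {X : Finset α} {Y : Finset β} (h : X.card = Y.card) (s : ℕ) :
    IsIso (unif X s) (unif Y s) := by
  let e : (unif X s).E ≃ (unif Y s).E := Finset.equivOfCardEq h
  refine ⟨e, fun I => ?_⟩
  have h1 : (Subtype.val '' (e '' I) : Set β).ncard = (Subtype.val '' I : Set α).ncard := by
    rw [Set.ncard_image_of_injective _ Subtype.val_injective,
      Set.ncard_image_of_injective _ e.injective,
      Set.ncard_image_of_injective _ Subtype.val_injective]
  have h2 : (Subtype.val '' I : Set α) ⊆ X := by
    rintro _ ⟨x, -, rfl⟩; exact x.2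
  have h3 : (Subtype.val '' (e '' I) : Set β) ⊆ Y := by
    rintro _ ⟨x, -, rfl⟩; exact x.2
  exact (and_iff_right h2).trans ((Iff.of_eq (by rw [h1])).trans (and_iff_right h3).symm)

namespace IsoClass

/-- The class of the matroid consisting of a single coloop. -/
noncomputable def coloop : IsoClass := mk (unif ({0} : Finset ℕ) 1)

/-- The class of the matroid consisting of a single loop. -/
noncomputable def loop : IsoClass := mk (unif ({0} : Finset ℕ) 0)

/-- Folding `α ⊕ α` onto `α` is injective on the ground set because `X` and `Y` are disjoint. The
hypothesis `h` matches the independent sets. It is applied to all-loop and to all-coloop matroids,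
where a direct sum of uniform matroids is again uniform. -/
theorem mk_mul_mk_eq_of_disjoint [DecidableEq α] {X Y : Finset α} (hd : Disjoint X Y)
    {s t u : ℕ} (h : ∀ I : Set α, I ⊆ X ∪ Y →
      (I.ncard ≤ u ↔ (I ∩ X).ncard ≤ s ∧ (I ∩ Y).ncard ≤ t)) :
    mk (unif X s) * mk (unif Y t) = mk (unif (X ∪ Y) u) := by
  rw [mk_mul_mk, mk_eq_mk]
  have hinj : Set.InjOn (Sum.elim id id : α ⊕ α → α) ((unif X s).sum (unif Y t)).E := by
    rw [Matroid.sum_ground]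
    rintro (x | x) hx (y | y) hy hxy <;> simp at hx hy hxy ⊢
    · exact hxy
    · exact Finset.disjoint_left.1 hd hx (hxy ▸ hy)
    · exact Finset.disjoint_left.1 hd hy (hxy ▸ hx)
    · exact hxy
  have e : unif (X ∪ Y) u = ((unif X s).sum (unif Y t)).map _ hinj := by
    have hE : (((unif X s).sum (unif Y t)).map _ hinj).E = (X : Set α) ∪ Y := by
      simp [Set.image_union, Set.image_image]
    refine Matroid.ext_indep (by rw [hE]; simp) fun J hJ => ?_
    have hJ1 : J ⊆ (X : Set α) ∪ Y := by simpa using hJ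
    have hJ2 : J = Sum.elim id id '' (Sum.inl '' (J ∩ X) ∪ Sum.inr '' (J ∩ Y)) := by
      rw [Set.image_union, Set.image_image, Set.image_image]
      simpa [← Set.inter_union_distrib_left] using hJ1
    have hl : (Sum.inl ⁻¹' (Sum.inl '' (J ∩ X) ∪ Sum.inr '' (J ∩ Y)) : Set α) = J ∩ X := by
      ext; simp
    have hr : (Sum.inr ⁻¹' (Sum.inl '' (J ∩ X) ∪ Sum.inr '' (J ∩ Y)) : Set α) = J ∩ Y := by
      ext; simp
    conv_rhs => rw [hJ2]
    rw [Matroid.map_image_indep_iff, Matroid.sum_indep_iff, hl, hr]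
    · simp only [unif_indep_iff, Finset.coe_union, hJ1, true_and, Set.inter_subset_right, h J hJ1]
    · rw [Matroid.sum_ground]
      exact Set.union_subset_union (Set.image_mono Set.inter_subset_right)
        (Set.image_mono Set.inter_subset_right)
  rw [e]
  exact isIso_map _ _ _

theorem mk_unif_insert_zero [DecidableEq α] {X : Finset α} {x : α} (hx : x ∉ X) :
    mk (unif (insert x X) 0) = loop * mk (unif X 0) := by
  have h1 : loop = mk (unif ({x} : Finset α) 0) := mk_eq_mk.2 (isIso_unif (by simp) 0)
  rw [h1, mk_mul_mk_eq_of_disjoint (u := 0) (by simpa using hx)]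
  · rfl
  · intro I hI
    have hf : I.Finite := (({x} : Finset α).finite_toSet.union X.finite_toSet).subset hI
    simp only [nonpos_iff_eq_zero, Set.ncard_eq_zero hf,
      Set.ncard_eq_zero (hf.subset Set.inter_subset_left)]
    constructor
    · rintro rfl; simp
    · rintro ⟨h1, h2⟩
      rw [← Set.inter_eq_left.2 hI, Set.inter_union_distrib_left, h1, h2, Set.union_empty]

theorem mk_unif_zero (X : Finset α) : mk (unif X 0) = loop ^ X.card := by
  classical
  induction X using Finset.induction_on with
  | empty => rw [Finset.card_empty, pow_zero, mk_of_ground_empty _ (by simp)]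
  | insert x X hx ih =>
    rw [mk_unif_insert_zero hx, ih, Finset.card_insert_of_notMem hx, pow_succ']

theorem mk_unif_insert_top [DecidableEq α] {X : Finset α} {x : α} (hx : x ∉ X) :
    mk (unif (insert x X) (insert x X).card) = coloop * mk (unif X X.card) := by
  have h1 : coloop = mk (unif ({x} : Finset α) 1) := mk_eq_mk.2 (isIso_unif (by simp) 1)
  rw [h1, mk_mul_mk_eq_of_disjoint (u := (insert x X).card) (by simpa using hx)]
  · rfl
  · intro I hI
    -- All three matroids are free, so every cardinality bound holds.
    refine iff_of_true ?_ ⟨?_, ?_⟩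
    · rw [← Set.ncard_coe_finset]
      refine Set.ncard_le_ncard ?_ (Finset.finite_toSet _)
      rwa [Finset.insert_eq, Finset.coe_union]
    · exact (Set.ncard_le_ncard Set.inter_subset_right (Finset.finite_toSet _)).trans (by simp)
    · exact (Set.ncard_le_ncard Set.inter_subset_right (Finset.finite_toSet _)).trans (by simp)

theorem mk_unif_card (X : Finset α) : mk (unif X X.card) = coloop ^ X.card := by
  classical
  induction X using Finset.induction_on with
  | empty => rw [Finset.card_empty, pow_zero, mk_of_ground_empty _ (by simp)]
  | insert x X hx ih =>
    rw [mk_unif_insert_top hx, ih, Finset.card_insert_of_notMem hx, pow_succ']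

theorem mk_unif_of_card_le {X : Finset α} {s : ℕ} (h : X.card ≤ s) :
    mk (unif X s) = coloop ^ X.card := by
  rw [← mk_unif_card]
  exact mk_congr (unif_eq_of_card_le h le_rfl)

end IsoClass

end UniformMinors

/-! ### Membership of minors in the class, and the recursion for the antipode. -/

section Family

open IsoClass

variable {α : Type*} (P : MatroidFamily)

/-- Transports closure under restriction from the representative on `ℕ` to a matroid on any type. -/
theorem MatroidFamily.mk_restrict_mem {M : Matroid α} [M.Finite]
    (hM : IsoClass.mk M ∈ P.toSubmonoid) {A : Finset α} (hA : (A : Set α) ⊆ M.E) :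
    IsoClass.mk (M ↾ (A : Set α)) ∈ P.toSubmonoid := by
  classical
  obtain ⟨f, hf, h⟩ := (isIso_rep_mk M).exists_map
  have h1 : IsoClass.mk (M ↾ (A : Set α)) =
      IsoClass.mk ((IsoClass.mk M).rep ↾ ((A.image f : Finset ℕ) : Set ℕ)) := by
    refine mk_eq_mk.2 ?_
    simp only [h, Finset.coe_image, map_restrict M f hf hA]
    exact isIso_map _ _ _
  rw [h1]
  refine P.restrict_mem hM ?_
  rw [h, Finset.coe_image]
  exact Set.image_mono hA

theorem MatroidFamily.mk_contract_mem {M : Matroid α} [M.Finite]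
    (hM : IsoClass.mk M ∈ P.toSubmonoid) {A : Finset α} (hA : (A : Set α) ⊆ M.E) :
    IsoClass.mk (M ／ (A : Set α)) ∈ P.toSubmonoid := by
  classical
  obtain ⟨f, hf, h⟩ := (isIso_rep_mk M).exists_map
  have h1 : IsoClass.mk (M ／ (A : Set α)) =
      IsoClass.mk ((IsoClass.mk M).rep ／ ((A.image f : Finset ℕ) : Set ℕ)) := by
    refine mk_eq_mk.2 ?_
    simp only [h, Finset.coe_image, map_contract M f hf hA]
    exact isIso_map _ _ _
  rw [h1]
  exact P.contract_mem hM _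

/-- A direct summand is the restriction of the sum to its own ground set, hence a minor of it. -/
theorem MatroidFamily.left_mem_of_mul_mem {x y : IsoClass} (h : x * y ∈ P.toSubmonoid) :
    x ∈ P.toSubmonoid := by
  classical
  rw [← mk_rep x, ← mk_rep y, mk_mul_mk] at h
  have hA : (((ground x.rep).disjSum ∅ : Finset (ℕ ⊕ ℕ)) : Set (ℕ ⊕ ℕ)) =
      Sum.inl '' x.rep.E ∪ Sum.inr '' ∅ := by
    ext (a | a) <;> simp [ground]
  have := P.mk_restrict_mem h (A := (ground x.rep).disjSum ∅) (by
    rw [hA, Matroid.sum_ground]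
    exact Set.union_subset_union_right _ (Set.image_mono (Set.empty_subset _)))
  have e : IsoClass.mk ((x.rep.sum y.rep) ↾
      (((ground x.rep).disjSum ∅ : Finset (ℕ ⊕ ℕ)) : Set (ℕ ⊕ ℕ))) =
      x * 1 := by
    rw [← mk_of_ground_empty (y.rep ↾ ((∅ : Finset ℕ) : Set ℕ)) (by simp)]
    conv_rhs => rw [← mk_rep x]
    rw [mk_mul_mk]
    apply mk_congr
    rw [hA, sum_restrict, Matroid.restrict_ground_eq_self, Finset.coe_empty]
  rwa [e, mul_one] at this

namespace MinorAlgebra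

variable {k : Type*} [Field k] {P}

/-- No membership is required: a direct sum lies in the class exactly when both summands do, so
otherwise both sides are `0`. Computations with `cls` thus avoid membership side conditions. -/
theorem cls_mul' (x y : IsoClass) : cls k P (x * y) = cls k P x * cls k P y := by
  by_cases h : x * y ∈ P.toSubmonoid
  · exact cls_mul (P.left_mem_of_mul_mem h) (P.left_mem_of_mul_mem (mul_comm x y ▸ h))
  · have : ¬ (x ∈ P.toSubmonoid ∧ y ∈ P.toSubmonoid) := fun h' => h (mul_mem h'.1 h'.2)
    rw [cls, dif_neg h]
    rcases not_and_or.1 this with h' | h'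
    · rw [cls, dif_neg h', zero_mul]
    · rw [cls.eq_def k P y, dif_neg h', mul_zero]

theorem cls_pow (x : IsoClass) (n : ℕ) : cls k P (x ^ n) = cls k P x ^ n := by
  induction n with
  | zero => rw [pow_zero, pow_zero, cls_one]
  | succ n ih => rw [pow_succ, pow_succ, cls_mul', ih]

/-- This is `id * S = η ∘ ε` at `M`; the counit vanishes because the ground set is nonempty. -/
theorem sum_cls_mul_antipode {M : Matroid α} [M.Finite] (hM : IsoClass.mk M ∈ P.toSubmonoid)
    (h : M.E.Nonempty) :
    ∑ A ∈ (ground M).powerset, cls k P (IsoClass.mk (M ↾ (A : Set α))) *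
      HopfAlgebra.antipode k (cls k P (IsoClass.mk (M ／ (A : Set α)))) = 0 := by
  have h1 := HopfAlgebra.mul_antipode_lTensor_comul_apply (R := k) (cls k P (IsoClass.mk M))
  rw [comul_cls hM, splitSum_mk, counit_cls hM, if_neg, map_zero] at h1
  · rw [← h1]
    simp only [map_sum, LinearMap.lTensor_tmul, LinearMap.mul'_apply]
  · rw [card_mk, Set.ncard_eq_zero M.ground_finite]
    exact h.ne_empty

theorem sum_unif_mul_antipode [DecidableEq α] {X : Finset α} {s : ℕ}
    (hX : IsoClass.mk (unif X s) ∈ P.toSubmonoid) (h : X.Nonempty) :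
    ∑ A ∈ X.powerset, cls k P (IsoClass.mk (unif A s)) *
      HopfAlgebra.antipode k (cls k P (IsoClass.mk (unif (X \ A) (s - A.card)))) = 0 := by
  have hg : ground (unif X s) = X := by
    apply Finset.coe_injective; simp
  rw [← sum_cls_mul_antipode (k := k) hX (by simpa using h), hg]
  refine Finset.sum_congr rfl fun A hA => ?_
  rw [Finset.mem_powerset] at hA
  rw [mk_congr (unif_restrict hA s), mk_congr (unif_contract hA s)]

end MinorAlgebra

end Family

/-! ### Inversion over the subset lattice. -/

section Inversion

variable {α R : Type*} [DecidableEq α] [CommRing R]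

/-- Convolving `(-c) ^ |B|` with `c ^ |C|` gives, at `D = B ∪ C`, the value `c ^ |D| * ∑_{B ⊆ D}
(-1) ^ |B|`, which is `1` for `D = ∅` and `0` otherwise. -/
theorem sum_powerset_inversion (c : R) (f g : Finset α → R) (X : Finset α)
    (h : ∀ Y ⊆ X, ∑ A ∈ Y.powerset, c ^ A.card * f (Y \ A) = g Y) :
    f X = ∑ A ∈ X.powerset, (-c) ^ A.card * g (X \ A) := by
  have h1 : ∑ A ∈ X.powerset, (-c) ^ A.card * g (X \ A) =
      ∑ B ∈ X.powerset, ∑ C ∈ (X \ B).powerset,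
        (-1) ^ B.card * (c ^ (B ∪ C).card * f (X \ (B ∪ C))) := by
    refine Finset.sum_congr rfl fun B _ => ?_
    rw [← h _ Finset.sdiff_subset, Finset.mul_sum]
    refine Finset.sum_congr rfl fun C hC => ?_
    rw [Finset.mem_powerset, Finset.subset_sdiff] at hC
    rw [Finset.card_union_of_disjoint hC.2.symm, neg_pow, pow_add, sdiff_sdiff_left,
      Finset.sup_eq_union]
    ring
  rw [h1, ← sum_powerset_powerset X fun D B => (-1) ^ B.card * (c ^ D.card * f (X \ D))]
  have h2 : ∀ D : Finset α, ∑ B ∈ D.powerset, (-1 : R) ^ B.card = if D = ∅ then 1 else 0 := by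
    intro D
    have := congrArg (Int.cast : ℤ → R) (Finset.sum_powerset_neg_one_pow_card (x := D))
    push_cast at this
    exact this
  simp only [← Finset.sum_mul, h2]
  rw [Finset.sum_eq_single ∅ (fun D _ hD => by rw [if_neg hD, zero_mul]) (by simp)]
  simp

theorem sum_ssubsets_neg_one_pow_card {D : Finset α} (hD : D.Nonempty) :
    ∑ I ∈ D.ssubsets, (-1 : R) ^ I.card = -(-1) ^ D.card := by
  have := congrArg (Int.cast : ℤ → R) (Finset.sum_powerset_neg_one_pow_card_of_nonempty hD)
  push_cast at this
  rw [eq_neg_iff_add_eq_zero, ← this, Finset.ssubsets,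
    Finset.sum_erase_add _ _ (Finset.mem_powerset_self D)]

end Inversion

/-! ### Combinatorics of the index pairs `(I, J)`. -/

section Pairs

variable (E : Type*) [Fintype E] [LinearOrder E]

/-- The pairs `(I, J)` of disjoint subsets of `E` such that `|I| < r` and `|I| + |J| = r`. -/
def splitIndex (r : ℕ) : Finset (Finset E × Finset E) :=
  Finset.univ.filter fun p => Disjoint p.1 p.2 ∧ p.1.card < r ∧ p.1.card + p.2.card = r

/-- The pairs `(I, J)` of disjoint subsets of `E` such that `|I| < r` and `|I| + |J| > r`. -/
def spanIndex (r : ℕ) : Finset (Finset E × Finset E) :=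
  Finset.univ.filter fun p => Disjoint p.1 p.2 ∧ p.1.card < r ∧ r < p.1.card + p.2.card

/-- The pairs `(I, {x})` such that `max I < x` and `|I| + 1 = r`. -/
def maxIndex (r : ℕ) : Finset (Finset E × Finset E) :=
  Finset.univ.filter fun p => p.1.card + p.2.card = r ∧ ∃ x, p.2 = {x} ∧ ∀ i ∈ p.1, i < x

variable {E}

/-- When the sizes add up to `r`, the conditions `Disjoint I J` and `|I| < r` follow from `J = {x}`
and `max I < x`, so `maxIndex` omits them. -/
theorem sum_pairIndex {V : Type*} [AddCommMonoid V] (r : ℕ) (T : Finset E × Finset E → V) :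
    ∑ p ∈ pairIndex E r, T p = ∑ p ∈ maxIndex E r, T p + ∑ p ∈ spanIndex E r, T p := by
  rw [← Finset.sum_filter_add_sum_filter_not _ fun p : Finset E × Finset E =>
    p.1.card + p.2.card = r]
  congr 1
  · refine Finset.sum_congr ?_ fun _ _ => rfl
    ext p
    simp only [pairIndex, maxIndex, Finset.mem_filter, Finset.mem_univ, true_and]
    constructor
    · rintro ⟨⟨-, -, -, h⟩, h'⟩
      exact ⟨h', h h'⟩
    · rintro ⟨h', x, hx, hlt⟩
      have : p.2.card = 1 := by rw [hx, Finset.card_singleton]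
      refine ⟨⟨?_, by omega, by omega, fun _ => ⟨x, hx, hlt⟩⟩, h'⟩
      rw [hx, Finset.disjoint_singleton_right]
      exact fun h => lt_irrefl _ (hlt x h)
  · refine Finset.sum_congr ?_ fun _ _ => rfl
    ext p
    simp only [pairIndex, spanIndex, Finset.mem_filter, Finset.mem_univ, true_and]
    constructor
    · rintro ⟨⟨h1, h2, h3, -⟩, h'⟩
      exact ⟨h1, h2, by omega⟩
    · rintro ⟨h1, h2, h3⟩
      exact ⟨⟨h1, h2, by omega, by omega⟩, by omega⟩

theorem sum_disjoint_pairs {V : Type*} [AddCommMonoid V] (r : ℕ) (T : Finset E × Finset E → V) :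
    (∑ I : Finset E, ∑ J ∈ (Finset.univ \ I).powerset,
      if I.card < r ∧ r ≤ I.card + J.card then T (I, J) else 0) =
      ∑ p ∈ splitIndex E r, T p + ∑ p ∈ spanIndex E r, T p := by
  rw [← Finset.sum_union, Finset.sum_sigma', ← Finset.sum_filter]
  · refine Finset.sum_bij' (fun q _ => (q.1, q.2)) (fun p _ => ⟨p.1, p.2⟩) ?_ ?_
      (fun _ _ => rfl) (fun _ _ => rfl) (fun _ _ => rfl)
    · rintro ⟨I, J⟩ h
      simp only [Finset.mem_filter, Finset.mem_sigma, Finset.mem_powerset,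
        Finset.subset_sdiff, Finset.mem_univ, true_and] at h
      simp only [splitIndex, spanIndex, Finset.mem_union, Finset.mem_filter, Finset.mem_univ,
        true_and, h.1.2.symm, h.2.1]
      exact h.2.2.eq_or_lt.imp Eq.symm id
    · rintro ⟨I, J⟩ h
      simp only [splitIndex, spanIndex, Finset.mem_union, Finset.mem_filter, Finset.mem_univ,
        true_and] at h
      simp only [Finset.mem_filter, Finset.mem_sigma, Finset.mem_powerset,
        Finset.subset_sdiff, Finset.mem_univ, true_and]
      rcases h with ⟨h1, h2, h3⟩ | ⟨h1, h2, h3⟩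
      · exact ⟨⟨Finset.subset_univ J, h1.symm⟩, h2, h3.ge⟩
      · exact ⟨⟨Finset.subset_univ J, h1.symm⟩, h2, h3.le⟩
  · rw [Finset.disjoint_left]
    intro p h h'
    simp only [splitIndex, spanIndex, Finset.mem_filter] at h h'
    omega

/-- The pair `(I, {x})` corresponds to the `r`-set `I ∪ {x}`; the inverse splits off the maximum,
which exists because `r ≥ 1`. -/
theorem card_maxIndex {r : ℕ} (hr : 1 ≤ r) :
    (maxIndex E r).card = (Finset.powersetCard r (Finset.univ : Finset E)).card := by
  refine Finset.card_bij (fun p _ => p.1 ∪ p.2) ?_ ?_ ?_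
  · rintro ⟨I, J⟩ h
    simp only [maxIndex, Finset.mem_filter, Finset.mem_univ, true_and] at h
    obtain ⟨h, x, rfl, hx⟩ := h
    rw [Finset.mem_powersetCard_univ, Finset.card_union_of_disjoint, h]
    rw [Finset.disjoint_singleton_right]
    exact fun h => lt_irrefl _ (hx x h)
  · rintro ⟨I, J⟩ h ⟨I', J'⟩ h' e
    simp only [maxIndex, Finset.mem_filter, Finset.mem_univ, true_and] at h h' e
    obtain ⟨-, x, rfl, hx⟩ := h
    obtain ⟨-, y, rfl, hy⟩ := h'
    have hxI : x ∉ I := fun h => lt_irrefl _ (hx x h)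
    have hyI : y ∉ I' := fun h => lt_irrefl _ (hy y h)
    have h1 : x ∈ I' ∪ {y} := e ▸ by simp
    have h2 : y ∈ I ∪ {x} := e ▸ by simp
    -- Both `x` and `y` are the maximum of the common union.
    have hxy : x = y := by
      rw [Finset.mem_union, Finset.mem_singleton] at h1 h2
      rcases h1 with h1 | h1
      · rcases h2 with h2 | h2
        · exact absurd (hx y h2) (hy x h1).not_gt
        · exact h2.symm
      · exact h1
    subst hxy
    have : I = I' := by
      rw [← Finset.erase_insert hxI, ← Finset.erase_insert hyI, Finset.insert_eq,
        Finset.insert_eq, Finset.union_comm, e, Finset.union_comm]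
    rw [this]
  · intro D hD
    rw [Finset.mem_powersetCard_univ] at hD
    have hne : D.Nonempty := Finset.card_pos.1 (by omega)
    refine ⟨(D.erase (D.max' hne), {D.max' hne}), ?_, ?_⟩
    · simp only [maxIndex, Finset.mem_filter, Finset.mem_univ, true_and]
      refine ⟨?_, _, rfl, fun i hi => ?_⟩
      · rw [Finset.card_erase_of_mem (D.max'_mem hne), Finset.card_singleton]; omega
      · exact lt_of_le_of_ne (D.le_max' i (Finset.mem_of_mem_erase hi)) (Finset.ne_of_mem_erase hi)
    · rw [Finset.union_comm, ← Finset.insert_eq, Finset.insert_erase (D.max'_mem hne)]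

/-- Fix the union `D` of the pair: `I` then runs over the proper subsets of `D`. The alternating sum
over all subsets is `0`, so each `D` contributes minus the missing term `(-1) ^ r`. -/
theorem sum_splitIndex_neg_one_pow {R : Type*} [CommRing R] {r : ℕ} (hr : 1 ≤ r) :
    ∑ p ∈ splitIndex E r, (-1 : R) ^ p.1.card =
      (maxIndex E r).card * -(-1) ^ r := by
  have h : ∑ p ∈ splitIndex E r, (-1 : R) ^ p.1.card =
      ∑ D ∈ Finset.powersetCard r (Finset.univ : Finset E), ∑ I ∈ D.ssubsets,
        (-1 : R) ^ I.card := by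
    rw [Finset.sum_sigma']
    refine Finset.sum_bij' (fun p _ => ⟨p.1 ∪ p.2, p.1⟩) (fun q _ => (q.2, q.1 \ q.2)) ?_ ?_ ?_ ?_ ?_
    · rintro ⟨I, J⟩ h
      simp only [splitIndex, Finset.mem_filter, Finset.mem_univ, true_and] at h
      simp only [Finset.mem_sigma, Finset.mem_powersetCard_univ, Finset.mem_ssubsets,
        Finset.card_union_of_disjoint h.1, h.2.2, true_and]
      refine Finset.ssubset_iff_subset_ne.2 ⟨Finset.subset_union_left, fun e => ?_⟩
      have := congrArg Finset.card e
      rw [Finset.card_union_of_disjoint h.1] at this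
      omega
    · rintro ⟨D, I⟩ h
      simp only [Finset.mem_sigma, Finset.mem_powersetCard_univ, Finset.mem_ssubsets] at h
      simp only [splitIndex, Finset.mem_filter, Finset.mem_univ, true_and]
      have h1 := Finset.card_lt_card h.2
      have h2 := Finset.card_sdiff_add_card_eq_card h.2.subset
      exact ⟨Finset.disjoint_sdiff, by omega, by omega⟩
    · rintro ⟨I, J⟩ h
      simp only [splitIndex, Finset.mem_filter, Finset.mem_univ, true_and] at h
      simp [Finset.union_sdiff_cancel_left h.1]
    · rintro ⟨D, I⟩ h
      simp only [Finset.mem_sigma, Finset.mem_powersetCard_univ, Finset.mem_ssubsets] at h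
      simp [Finset.union_sdiff_of_subset h.2.subset]
    · intro p _; rfl
  rw [h, card_maxIndex hr, ← nsmul_eq_mul]
  refine Finset.sum_eq_card_nsmul fun D hD => ?_
  rw [Finset.mem_powersetCard_univ] at hD
  rw [sum_ssubsets_neg_one_pow_card (Finset.card_pos.1 (by omega)), hD]

end Pairs

/-! ### The antipode of uniform matroids. -/

section Antipode

open IsoClass MinorAlgebra

variable {k : Type*} [Field k] {P : MatroidFamily} {α : Type*}

/-- In rank `0` every restriction is a power of `loop`, so the recursion convolves `loop ^ |A|` with
the antipodes to give the indicator of `∅`; inversion leaves only the term `A = X`. -/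
theorem MinorAlgebra.antipode_unif_zero {X : Finset α}
    (hX : IsoClass.mk (unif X 0) ∈ P.toSubmonoid) :
    HopfAlgebra.antipode k (cls k P (IsoClass.mk (unif X 0))) = (-cls k P loop) ^ X.card := by
  classical
  rw [sum_powerset_inversion (cls k P loop)
    (fun Y => HopfAlgebra.antipode k (cls k P (IsoClass.mk (unif Y 0))))
    (fun Y => if Y = ∅ then 1 else 0) X, Finset.sum_eq_single X]
  · simp
  · intro A hA hne
    rw [Finset.mem_powerset] at hA
    rw [if_neg, mul_zero]
    rw [Finset.sdiff_eq_empty_iff_subset]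
    exact fun h => hne (hA.antisymm h)
  · simp
  · intro Y hY
    split_ifs with h
    · subst h
      rw [Finset.powerset_empty, Finset.sum_singleton, Finset.card_empty, pow_zero, one_mul,
        Finset.sdiff_empty, mk_of_ground_empty _ (by simp), cls_one, HopfAlgebra.antipode_one]
    · have hYP : IsoClass.mk (unif Y 0) ∈ P.toSubmonoid := by
        rw [← mk_congr (unif_restrict hY 0)]
        exact P.mk_restrict_mem hX (by simpa using hY)
      rw [← sum_unif_mul_antipode (k := k) hYP (Finset.nonempty_iff_ne_empty.2 h)]
      refine Finset.sum_congr rfl fun A _ => ?_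
      rw [mk_unif_zero A, cls_pow, Nat.zero_sub]

variable {E : Type*} [Fintype E] [LinearOrder E]

/-- Contract `A`, then restrict to `B`. Every summand on the right-hand side of the theorem arises
this way. -/
theorem MatroidFamily.mk_unif_sdiff_mem {r : ℕ}
    (hU : IsoClass.mk (unif (Finset.univ : Finset E) r) ∈ P.toSubmonoid) {A B : Finset E}
    (hd : Disjoint A B) : IsoClass.mk (unif B (r - A.card)) ∈ P.toSubmonoid := by
  have h1 := P.mk_contract_mem hU (A := A) (by simp)
  rw [mk_congr (unif_contract (Finset.subset_univ A) r)] at h1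
  have h2 : B ⊆ Finset.univ \ A := by
    rw [Finset.subset_sdiff]
    exact ⟨Finset.subset_univ B, hd.symm⟩
  rw [← mk_congr (unif_restrict h2 _)]
  exact P.mk_restrict_mem h1 (by simpa using Finset.coe_subset.2 h2)

theorem pairTerm_mem {r : ℕ}
    (hU : IsoClass.mk (unif (Finset.univ : Finset E) r) ∈ P.toSubmonoid)
    {p : Finset E × Finset E} (hp : p ∈ pairIndex E r) : pairTerm r p ∈ P.toSubmonoid := by
  simp only [pairIndex, Finset.mem_filter, Finset.mem_univ, true_and] at hp
  obtain ⟨hd, hlt, hle, -⟩ := hp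
  refine mul_mem (mul_mem ?_ (P.mk_unif_sdiff_mem hU hd)) ?_
  -- Restricting to `I` alone gives a free matroid, since `|I| < r`.
  · have := P.mk_unif_sdiff_mem hU (Finset.disjoint_empty_left p.1)
    rwa [mk_congr (unif_eq_of_card_le (t := p.1.card) (by simpa using hlt.le) le_rfl)] at this
  -- Contracting `I ∪ J`, which has at least `r` elements, leaves rank `0`.
  · have := P.mk_unif_sdiff_mem hU (Finset.disjoint_sdiff (s := p.1 ∪ p.2) (t := Finset.univ))
    rwa [Finset.card_union_of_disjoint hd, Nat.sub_eq_zero_of_le hle] at this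

/-- A formula for the antipode of a uniform matroid in which the pairs of total size `r` still
cancel partially. -/
theorem MinorAlgebra.antipode_unif {r : ℕ} (hr : 1 ≤ r) (hrn : r ≤ Fintype.card E)
    (hU : IsoClass.mk (unif (Finset.univ : Finset E) r) ∈ P.toSubmonoid) :
    HopfAlgebra.antipode k (cls k P (IsoClass.mk (unif (Finset.univ : Finset E) r))) =
      ∑ I : Finset E, ∑ J ∈ (Finset.univ \ I).powerset,
        if I.card < r ∧ r ≤ I.card + J.card then
          (-1) ^ (Fintype.card E - J.card + 1) * cls k P (pairTerm r (I, J)) else 0 := by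
  -- Here `Y` stands for the contraction by `Yᶜ`. The default value `0` for `|Yᶜ| ≥ r` removes the
  -- large `A` from the convolution; their contribution is collected, with opposite sign, in the
  -- second function.
  have key := sum_powerset_inversion (cls k P coloop)
    (fun Y : Finset E => if Yᶜ.card < r then
      HopfAlgebra.antipode k (cls k P (IsoClass.mk (unif Y (r - Yᶜ.card)))) else 0)
    (fun Y => if Yᶜ.card < r then -∑ J ∈ Y.powerset, if r ≤ Yᶜ.card + J.card then
      cls k P (IsoClass.mk (unif J (r - Yᶜ.card))) * (-cls k P loop) ^ (Y \ J).card else 0 else 0)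
    Finset.univ ?_
  · have h0 : (Finset.univᶜ : Finset E).card = 0 := by simp
    simp only [h0, if_pos (show 0 < r from hr), Nat.sub_zero, Finset.powerset_univ] at key
    rw [key]
    refine Finset.sum_congr rfl fun I _ => ?_
    have hI : (Finset.univ \ I)ᶜ = I := by rw [← Finset.compl_eq_univ_sdiff, compl_compl]
    rw [hI]
    split_ifs with hlt
    · rw [mul_neg, Finset.mul_sum, ← Finset.sum_neg_distrib]
      refine Finset.sum_congr rfl fun J hJ => ?_
      simp only [hlt, true_and]
      split_ifs with hle
      · rw [Finset.mem_powerset, Finset.subset_sdiff] at hJ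
        have hc : ((Finset.univ \ I) \ J).card + (I.card + J.card) = Fintype.card E := by
          rw [← Finset.card_union_of_disjoint hJ.2.symm, sdiff_sdiff_left, Finset.sup_eq_union,
            Finset.card_sdiff_add_card_eq_card (Finset.subset_univ _), Finset.card_univ]
        rw [pairTerm, cls_mul', cls_mul', mk_unif_card, mk_unif_zero, cls_pow, cls_pow,
          ← Finset.sup_eq_union, ← sdiff_sdiff_left,
          -- The sign has three sources: `|I|` from the inversion, `|E \ (I ∪ J)|` from the antipode
          -- of the loops, and `1` from moving the large `A` to the other side.
          show Fintype.card E - J.card + 1 = I.card + ((Finset.univ \ I) \ J).card + 1 by omega,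
          neg_pow, neg_pow (cls k P loop)]
        ring
      · rw [mul_zero, neg_zero]
    · simp [hlt]
  · intro Y _
    by_cases hlt : Yᶜ.card < r
    · have hYP : IsoClass.mk (unif Y (r - Yᶜ.card)) ∈ P.toSubmonoid :=
        P.mk_unif_sdiff_mem hU disjoint_compl_left
      have hcY : Yᶜ.card + Y.card = Fintype.card E := by rw [add_comm, Finset.card_add_card_compl]
      have h := sum_unif_mul_antipode (k := k) hYP (Finset.card_pos.1 (by omega))
      rw [if_pos hlt, eq_neg_iff_add_eq_zero, ← Finset.sum_add_distrib]
      refine Eq.trans ?_ h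
      refine Finset.sum_congr rfl fun A hA => ?_
      rw [Finset.mem_powerset] at hA
      have hcA : (Y \ A)ᶜ.card = Yᶜ.card + A.card := by
        have := Finset.card_sdiff_add_card_eq_card hA
        have := Finset.card_add_card_compl (Y \ A)
        omega
      -- For each `A` exactly one of the two sums contributes: either the contraction has rank `0`,
      -- or the restriction to `A` is free.
      by_cases hle : r ≤ Yᶜ.card + A.card
      · have hz : r - Yᶜ.card - A.card = 0 := by omega
        have hmem : IsoClass.mk (unif (Y \ A) 0) ∈ P.toSubmonoid := by
          have := P.mk_unif_sdiff_mem hU (disjoint_compl_left (a := Y \ A))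
          rwa [hcA, Nat.sub_eq_zero_of_le hle] at this
        rw [if_pos hle, if_neg (by omega), mul_zero, zero_add, hz, antipode_unif_zero hmem]
      · rw [if_neg hle, if_pos (by omega), add_zero, hcA,
          mk_unif_of_card_le (X := A) (by omega), cls_pow, Nat.sub_sub]
    -- Removing `A` from `Y` only enlarges the complement, so every term carries the default value
    -- `0`.
    · rw [if_neg hlt]
      refine Finset.sum_eq_zero fun A hA => ?_
      have : Yᶜ ⊆ (Y \ A)ᶜ := Finset.compl_subset_compl.2 Finset.sdiff_subset
      rw [if_neg (fun h => hlt ((Finset.card_le_card this).trans_lt h)), mul_zero]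

/-- Here `r - |I| = |J|`, so the middle factor is free too and the class depends on `r` alone. -/
theorem pairTerm_of_card_eq {r : ℕ} {p : Finset E × Finset E} (hd : Disjoint p.1 p.2)
    (h : p.1.card + p.2.card = r) : pairTerm r p = coloop ^ r * loop ^ (Fintype.card E - r) := by
  have hc : (Finset.univ \ (p.1 ∪ p.2)).card = Fintype.card E - r := by
    rw [Finset.card_sdiff_of_subset (Finset.subset_univ _), Finset.card_union_of_disjoint hd, h,
      Finset.card_univ]
  rw [pairTerm, mk_unif_card, mk_unif_of_card_le (by omega), mk_unif_zero, hc, ← pow_add, h]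

theorem sum_splitIndex_eq_sum_maxIndex {r : ℕ} (hr : 1 ≤ r) :
    ∑ p ∈ splitIndex E r, (-1) ^ (Fintype.card E - p.2.card + 1) * cls k P (pairTerm r p) =
      ∑ p ∈ maxIndex E r, (-1) ^ (Fintype.card E - p.2.card + 1) * cls k P (pairTerm r p) := by
  have hle : ∀ p : Finset E × Finset E, p.2.card ≤ Fintype.card E := fun p =>
    Finset.card_le_univ _
  have h1 : ∀ p ∈ splitIndex E r,
      (-1) ^ (Fintype.card E - p.2.card + 1) * cls k P (pairTerm r p) =
      (-1) ^ p.1.card * ((-1) ^ (Fintype.card E + r + 1) *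
        cls k P (coloop ^ r * loop ^ (Fintype.card E - r))) := by
    intro p hp
    simp only [splitIndex, Finset.mem_filter, Finset.mem_univ, true_and] at hp
    rw [pairTerm_of_card_eq hp.1 hp.2.2, ← mul_assoc, ← pow_add]
    congr 1
    have := hle p
    -- Since `|I| + |J| = r`, the two exponents differ by the even number `r + r`.
    rw [show p.1.card + (Fintype.card E + r + 1) =
      Fintype.card E - p.2.card + 1 + (r + r) by omega, pow_add _ _ (r + r),
      Even.neg_one_pow ⟨r, rfl⟩, mul_one]
  have h2 : ∀ p ∈ maxIndex E r,
      (-1) ^ (Fintype.card E - p.2.card + 1) * cls k P (pairTerm r p) =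
      (-1) ^ Fintype.card E * cls k P (coloop ^ r * loop ^ (Fintype.card E - r)) := by
    intro p hp
    simp only [maxIndex, Finset.mem_filter, Finset.mem_univ, true_and] at hp
    obtain ⟨hp, x, hx, hlt⟩ := hp
    have hd : Disjoint p.1 p.2 := by
      rw [hx, Finset.disjoint_singleton_right]
      exact fun h => lt_irrefl _ (hlt x h)
    have hc : p.2.card = 1 := by rw [hx, Finset.card_singleton]
    have := hle p
    rw [pairTerm_of_card_eq hd hp, hc, Nat.sub_add_cancel (by omega)]
  rw [Finset.sum_congr rfl h1, Finset.sum_congr rfl h2, ← Finset.sum_mul,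
    sum_splitIndex_neg_one_pow hr, Finset.sum_const, nsmul_eq_mul]
  have : (-1 : MinorAlgebra k P) ^ r * (-1) ^ r = 1 := by
    rw [← pow_add, Even.neg_one_pow ⟨r, rfl⟩]
  -- Each `r`-set gives `-(-1) ^ r * (-1) ^ (n + r + 1) = (-1) ^ n` on the left, which matches the
  -- exponent `n - 1 + 1` of its pair with `|J| = 1`.
  linear_combination ((maxIndex E r).card * (-1) ^ Fintype.card E *
    cls k P (coloop ^ r * loop ^ (Fintype.card E - r))) * this

end Antipode

end MatroidMinor

theorem mainTheorem5 {k : Type*} [Field k] (P : MatroidMinor.MatroidFamily)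
    {E : Type*} [Fintype E] [LinearOrder E] (r : ℕ) (hr : 1 ≤ r) (hrn : r ≤ Fintype.card E)
    (hU : MatroidMinor.IsoClass.mk (MatroidMinor.unif (Finset.univ : Finset E) r)
      ∈ P.toSubmonoid) :
    ∃ hmem : ∀ p ∈ MatroidMinor.pairIndex E r, MatroidMinor.pairTerm r p ∈ P.toSubmonoid,
      HopfAlgebra.antipode k (MatroidMinor.MinorAlgebra.single k P
          ⟨MatroidMinor.IsoClass.mk (MatroidMinor.unif (Finset.univ : Finset E) r), hU⟩) =
        ∑ p : MatroidMinor.pairIndex E r,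
          (-1 : k) ^ (Fintype.card E - p.1.2.card + 1) •
            MatroidMinor.MinorAlgebra.single k P
              ⟨MatroidMinor.pairTerm r p.1, hmem p.1 p.2⟩ := by
  open MatroidMinor MatroidMinor.MinorAlgebra in
  refine ⟨fun p hp => pairTerm_mem hU hp, ?_⟩
  have h1 : ∀ p : pairIndex E r, (-1 : k) ^ (Fintype.card E - p.1.2.card + 1) •
      single k P ⟨pairTerm r p.1, pairTerm_mem hU p.2⟩ =
      (-1) ^ (Fintype.card E - p.1.2.card + 1) * cls k P (pairTerm r p.1) := by
    intro p
    rw [← cls_of_mem, Algebra.smul_def, map_pow, map_neg, map_one]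
  -- After passing from `single` to `cls`, both sides are sums over pairs. They share the part with
  -- `|I| + |J| > r`, and the parts with `|I| + |J| = r` agree by the sign count.
  rw [Finset.sum_congr rfl fun p _ => h1 p, ← cls_of_mem, antipode_unif hr hrn hU,
    Finset.sum_coe_sort (pairIndex E r) fun p =>
      (-1) ^ (Fintype.card E - p.2.card + 1) * cls k P (pairTerm r p),
    sum_pairIndex, ← sum_splitIndex_eq_sum_maxIndex hr,
    sum_disjoint_pairs r fun p : Finset E × Finset E =>
      (-1) ^ (Fintype.card E - p.2.card + 1) * cls k P (pairTerm r p)]
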